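/- Let $0\le M\le N$ be integers, let $a=(a_1,\dots,a_M)$ and $b=(b_0,b_1,\dots,b_N)$ be tuples of positive real numbers, and let $\kappa>0$. For $\Re(w)>0$ let $\zeta_M(s,w\,|\,a)$ be the Barnes multiple zeta function, that is, the analytic continuation to $s\in\mathbb{C}\setminus\{1,\dots,M\}$ of $$\zeta_M(s,w\,|\,a)=\frac1{\Gamma(s)}\int_0^\infty t^{s-1}e^{-wt}\prod_{j=1}^M(1-e^{-a_jt})^{-1}\,dt,\qquad \Re(s)>M,$$ and let $L_M(w\,|\,a)=\partial_s\zeta_M(s,w\,|\,a)|_{s=0}$ be the Barnes multiple log-gamma function. For a function $h$ let $$(\mathcal S_Nh)(q\,|\,b)=\sum_{p=0}^N(-1)^p\sum_{1\le k_1<\dots<k_p\le N}h(q+b_0+b_{k_1}+\dots+b_{k_p}),$$ and for $\Re(q)>-b_0$ let $$\eta_{M,N}(q\,|\,a,b)=\exp\bigl((\mathcal S_NL_M(\cdot\,|\,a))(q\,|\,b)-(\mathcal S_NL_M(\cdot\,|\,a))(0\,|\,b)\bigr).$$ There is exactly one probability distribution on $(0,1]$ whose Mellin transform is $\eta_{M,N}(\cdot\,|\,a,b)$,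 i.e. such that a random variable $\beta_{M,N}(a,b)$ with this distribution satisfies $\mathbf{E}[\beta_{M,N}(a,b)^q]=\eta_{M,N}(q\,|\,a,b)$ for all complex $q$ with $\Re(q)>-b_0$; it is the Barnes beta distribution $\beta_{M,N}(a,b)$. The same holds for $(\kappa a,\kappa b)$ in place of $(a,b)$, where $(\kappa a)_i=\kappa a_i$ and $(\kappa b)_j=\kappa b_j$, and $$\beta_{M,N}(\kappa a,\kappa b)^{\kappa}\overset{\text{in law}}{=}\beta_{M,N}(a,b).$$ -/

import Mathlib

open MeasureTheory Set

noncomputable section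

/-- The function `f(t) = t ^ M * ∏ j, (1 - exp (-a_j t))⁻¹`, for `t > 0`. -/
def barnesF {M : ℕ} (a : Fin M → ℝ) (t : ℝ) : ℝ :=
  t ^ M * ∏ j, (1 - Real.exp (-(a j * t)))⁻¹

/-- The integral `(1 / Γ(s)) ∫₀^∞ t ^ (s - 1) e ^ (-w t) f(t) dt / t ^ M`, which defines the
multiple zeta function `ζ_M(s, w | a)` for `Re s > M` and `Re w > 0`. -/
def barnesZetaIntegral {M : ℕ} (a : Fin M → ℝ) (w s : ℂ) : ℂ :=
  (Complex.Gamma s)⁻¹ *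
    mellin (fun t : ℝ => Complex.exp (-w * (t : ℂ)) * ((barnesF a t / t ^ M : ℝ) : ℂ)) s

/-- `Z` is the analytic continuation of `s ↦ ζ_M(s, w | a)` from the half-plane `Re s > M` to the
complex plane without the points `1, …, M`. This domain is open and connected, so `Z` is unique
there. -/
def IsBarnesZetaContinuation {M : ℕ} (a : Fin M → ℝ) (w : ℂ) (Z : ℂ → ℂ) : Prop :=
  DifferentiableOn ℂ Z {s : ℂ | ∀ k : ℕ, 1 ≤ k → k ≤ M → s ≠ (k : ℂ)} ∧
    ∀ s : ℂ, (M : ℝ) < s.re → Z s = barnesZetaIntegral a w s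

/-- The Barnes multiple zeta function `ζ_M(s, w | a)`, continued analytically in `s`, for
`Re w > 0`. -/
def barnesZeta {M : ℕ} (a : Fin M → ℝ) (w : ℂ) : ℂ → ℂ :=
  Classical.epsilon (IsBarnesZetaContinuation a w)

/-- The Barnes multiple log-gamma function `L_M(w | a) = ∂_s ζ_M(s, w | a)` at `s = 0`, for
`Re w > 0`. -/
def barnesLogGamma {M : ℕ} (a : Fin M → ℝ) (w : ℂ) : ℂ :=
  deriv (barnesZeta a w) 0

/-- The operator `(S_N h)(q | b) = ∑_p (-1) ^ p ∑_{k_1 < ⋯ < k_p} h(q + b_0 + b_{k_1} + ⋯ + b_{k_p})`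
as a sum over the subsets `{k_1, …, k_p}` of `{1, …, N}`; here `b = (b_0, b_1, …, b_N)`. -/
def barnesS {N : ℕ} (b : Fin (N + 1) → ℝ) (h : ℂ → ℂ) (q : ℂ) : ℂ :=
  ∑ K : Finset (Fin N), (-1) ^ K.card * h (q + (b 0 : ℂ) + ∑ k ∈ K, (b k.succ : ℂ))

/-- The function `η_{M,N}(q | a, b)`, for `Re q > -b_0`. -/
def barnesEta {M N : ℕ} (a : Fin M → ℝ) (b : Fin (N + 1) → ℝ) (q : ℂ) : ℂ :=
  Complex.exp (barnesS b (barnesLogGamma a) q - barnesS b (barnesLogGamma a) 0)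

/-- `μ` is a probability distribution on `(0, 1]` with Mellin transform
`∫ x ^ q dμ(x) = η_{M,N}(q | a, b)` for `Re q > -b_0`. -/
structure IsBarnesBetaLaw {M N : ℕ} (a : Fin M → ℝ) (b : Fin (N + 1) → ℝ) (μ : Measure ℝ) :
    Prop where
  isProbabilityMeasure : IsProbabilityMeasure μ
  support : μ (Ioc (0 : ℝ) 1)ᶜ = 0
  integrable : ∀ q : ℂ, -b 0 < q.re → Integrable (fun x : ℝ => (x : ℂ) ^ q) μ
  mellin_eq : ∀ q : ℂ, -b 0 < q.re → ∫ x : ℝ, (x : ℂ) ^ q ∂μ = barnesEta a b q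

/-- The Barnes beta distribution `β_{M,N}(a, b)`: the law singled out by `IsBarnesBetaLaw`. -/
def barnesBeta {M N : ℕ} (a : Fin M → ℝ) (b : Fin (N + 1) → ℝ) : Measure ℝ :=
  Classical.epsilon (IsBarnesBetaLaw a b)

end

/-! The point is that `barnesEta` has Lévy–Khintchine form. With `barnesF` written `f`, analytic at
`0`, the zeta integral is `Γ(s)⁻¹` times the Mellin transform of `e^(-wt) f(t)` at `s - M`.
Subtracting Taylor polynomials shows that `Γ⁻¹` times this Mellin transform is entire, and the
quotient of `Γ(s)` by `Γ(s - M)` is a Pochhammer polynomial whose zeros are `1, …, M`; this gives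
the continuation.

The alternating sum over subsets multiplies the integrand by `∏ (1 - e^(-b_k t))`, a zero of order
`N ≥ M` at `t = 0`, and subtracting the value at `q = 0` adds one more order. The combined Mellin
integral therefore converges near `-M`. Since `1/Γ` has a simple zero with derivative `1` at `0`,
differentiating at `s = 0` leaves `∫ (e^(-qt) - 1) W(t) dt/t` with `W = barnesWeight ≥ 0`
(`barnesS_sub_barnesS`, `integrableOn_barnesWeight`).

After `x = e^(-t)` this is the exponent of a multiplicative infinitely divisible law on `(0, 1]`,
built as an infinite product of independent compound Poisson variables
(`exists_infinitelyDivisible`). Uniqueness is that of the characteristic function of `log x`. For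
the scaling, `W` for `(κa, κb)` at `t` is `W` for `(a, b)` at `κt`, and `dt/t` is invariant under
dilation. -/

open Filter Topology Asymptotics

/-! ### Entire extension of Mellin transforms divided by Gamma -/

/-- The identity theorem for two holomorphic functions on a right half-plane that agree on a
smaller one. -/
theorem eqOn_halfPlane_of_eqOn {f g : ℂ → ℂ} {x y : ℝ}
    (hf : DifferentiableOn ℂ f {s | x < s.re}) (hg : DifferentiableOn ℂ g {s | x < s.re})
    (hfg : ∀ s : ℂ, y < s.re → f s = g s) : ∀ s : ℂ, x < s.re → f s = g s := by
  have ho : ∀ z : ℝ, IsOpen {s : ℂ | z < s.re} := fun z =>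
    isOpen_lt continuous_const Complex.continuous_re
  have hc : IsPreconnected {s : ℂ | x < s.re} := (convex_halfSpace_re_gt x).isPreconnected
  have hz : ((max x y + 1 : ℝ) : ℂ) ∈ {s : ℂ | x < s.re} := by
    simp only [mem_ofPred_eq, Complex.ofReal_re]
    linarith [le_max_left x y]
  refine (hf.analyticOnNhd (ho x)).eqOn_of_preconnected_of_eventuallyEq
    (hg.analyticOnNhd (ho x)) hc hz ?_
  filter_upwards [(ho y).mem_nhds (show ((max x y + 1 : ℝ) : ℂ) ∈ {s : ℂ | y < s.re} by
    simp only [mem_ofPred_eq, Complex.ofReal_re]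
    linarith [le_max_right x y])] with s hs using hfg s hs

/-- A function on the right half-plane which extends holomorphically to every half-plane
`-n < re s` extends to an entire function. -/
theorem exists_differentiable_extension {g : ℂ → ℂ}
    (h : ∀ n : ℕ, ∃ φ : ℂ → ℂ, DifferentiableOn ℂ φ {s | -(n : ℝ) < s.re} ∧
      ∀ s : ℂ, 0 < s.re → φ s = g s) :
    ∃ φ : ℂ → ℂ, Differentiable ℂ φ ∧ ∀ s : ℂ, 0 < s.re → φ s = g s := by
  choose φ hφ hφg using h
  have key : ∀ m n : ℕ, ∀ s : ℂ, -(m : ℝ) < s.re → -(n : ℝ) < s.re → φ m s = φ n s := by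
    intro m n
    wlog hmn : m ≤ n generalizing m n
    · intro s hm hn
      exact (this n m (le_of_not_ge hmn) s hn hm).symm
    intro s hm _
    refine eqOn_halfPlane_of_eqOn (y := 0) (hφ m) ((hφ n).mono fun z hz => ?_)
      (fun z hz => (hφg m z hz).trans (hφg n z hz).symm) s hm
    have : (m : ℝ) ≤ n := by exact_mod_cast hmn
    simp only [mem_ofPred_eq] at hz ⊢
    linarith
  have hN : ∀ s : ℂ, -((⌊|s.re|⌋₊ + 1 : ℕ) : ℝ) < s.re := fun s => by
    have := Nat.lt_floor_add_one |s.re|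
    push_cast
    linarith [neg_abs_le s.re]
  -- The index jumps as `s` varies, but `key` makes all admissible indices agree, so near `s` the
  -- index belonging to `s` can be kept fixed.
  refine ⟨fun s => φ (⌊|s.re|⌋₊ + 1) s, fun s => ?_, fun s hs => hφg _ s hs⟩
  have ho : {z : ℂ | -((⌊|s.re|⌋₊ + 1 : ℕ) : ℝ) < z.re} ∈ 𝓝 s :=
    (isOpen_lt continuous_const Complex.continuous_re).mem_nhds (hN s)
  refine ((hφ _).differentiableAt ho).congr_of_eventuallyEq ?_
  filter_upwards [ho] with z hz using key _ _ z (hN z) hz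

theorem Gamma_add_nat_eq_ascPochhammer_mul {s : ℂ} (hs : 0 < s.re) (k : ℕ) :
    Complex.Gamma (s + k) = (ascPochhammer ℂ k).eval s * Complex.Gamma s := by
  rw [← Complex.Gamma_add_nat_div_Gamma_eq, div_mul_cancel₀ _ (Complex.Gamma_ne_zero_of_re_pos hs)]
  rintro m rfl
  simp only [Complex.neg_re, Complex.natCast_re] at hs
  linarith [(m.cast_nonneg : (0 : ℝ) ≤ m)]

theorem hasMellin_exp_neg_mul_pow {s : ℂ} (hs : 0 < s.re) (k : ℕ) :
    HasMellin (fun t : ℝ => ((Real.exp (-t) : ℝ) : ℂ) * (t : ℂ) ^ k) s (Complex.Gamma (s + k)) := by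
  have hsk : 0 < (s + k).re := by
    simp only [Complex.add_re, Complex.natCast_re]
    positivity
  have e : (fun t : ℝ => ((Real.exp (-t) : ℝ) : ℂ) * (t : ℂ) ^ k) =
      fun t : ℝ => (t : ℂ) ^ (k : ℂ) • ((Real.exp (-t) : ℝ) : ℂ) := by
    ext t
    rw [Complex.cpow_natCast, smul_eq_mul, mul_comm]
  rw [e, HasMellin, MellinConvergent.cpow_smul, mellin_cpow_smul, Complex.Gamma_eq_integral hsk,
    Complex.GammaIntegral_eq_mellin]
  refine ⟨?_, rfl⟩
  have := Complex.GammaIntegral_convergent hsk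
  refine this.congr_fun (fun t _ => ?_) measurableSet_Ioi
  simp [mul_comm]

theorem isBigO_exp_neg_mul_pow (k : ℕ) :
    (fun t : ℝ => ((Real.exp (-t) : ℝ) : ℂ) * (t : ℂ) ^ k) =O[atTop]
      fun t => Real.exp (-(1 / 2) * t) := by
  have h := (isLittleO_pow_exp_pos_mul_atTop (b := 1 / 2) k (by norm_num)).isBigO
  have h2 := (isBigO_refl (fun t : ℝ => Real.exp (-t)) atTop).mul h
  refine (IsBigO.of_norm_left (h2.norm_left.congr' ?_ ?_))
  · filter_upwards [eventually_ge_atTop 0] with t ht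
    rw [norm_mul, norm_mul, Complex.norm_real, norm_pow, norm_pow, Complex.norm_real]
  · filter_upwards with t
    rw [← Real.exp_add]
    ring_nf

/-- If `h` is smooth enough at `0` and decays exponentially, then `mellin h / Γ` extends to an
entire function. -/
theorem exists_differentiable_eq_mellin_div_Gamma {h H : ℝ → ℂ} (hH : AnalyticAt ℝ H 0)
    (hhH : h =ᶠ[𝓝[>] 0] H) (hc : ContinuousOn h (Ioi 0)) {a : ℝ} (ha : 0 < a)
    (htop : h =O[atTop] fun t => Real.exp (-a * t)) :
    ∃ φ : ℂ → ℂ, Differentiable ℂ φ ∧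
      ∀ s : ℂ, 0 < s.re → φ s = (Complex.Gamma s)⁻¹ * mellin h s := by
  refine exists_differentiable_extension fun n => ?_
  have hexp : AnalyticAt ℝ (fun t : ℝ => ((Real.exp t : ℝ) : ℂ)) 0 :=
    (Complex.ofRealCLM.analyticAt _).comp analyticAt_rexp
  -- Expanding `e^t H(t)` rather than `H` makes the approximant `P` equal to `e^(-t)` times a
  -- polynomial: it decays at infinity, and its Mellin transform is a combination of `Γ(s + k)`.
  obtain ⟨p, hp⟩ := hexp.mul hH
  set P : ℝ → ℂ := fun t => ∑ k ∈ Finset.range n, p.coeff k *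
    (((Real.exp (-t) : ℝ) : ℂ) * (t : ℂ) ^ k) with hP
  have hPc : Continuous P := by fun_prop
  have hr0 : (fun t => h t - P t) =O[𝓝[>] 0] fun t : ℝ => t ^ (-(-(n : ℝ))) := by
    have h1 := (hp.isBigO_sub_partialSum_pow n).mono (nhdsWithin_le_nhds (s := Ioi 0))
    have h2 : (fun t : ℝ => ((Real.exp (-t) : ℝ) : ℂ)) =O[𝓝[>] 0] fun _ => (1 : ℝ) := by
      have : ContinuousAt (fun t : ℝ => ((Real.exp (-t) : ℝ) : ℂ)) 0 := by fun_prop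
      exact (this.tendsto.isBigO_one ℝ).mono nhdsWithin_le_nhds
    refine (h2.mul h1).congr' ?_ ?_
    · filter_upwards [hhH] with t ht
      rw [ht, hP]
      simp only [zero_add, Pi.mul_apply, FormalMultilinearSeries.partialSum,
        FormalMultilinearSeries.apply_eq_pow_smul_coeff, mul_sub, Finset.mul_sum]
      rw [← mul_assoc, ← Complex.ofReal_mul, ← Real.exp_add]
      simp only [neg_add_cancel, Real.exp_zero, Complex.ofReal_one, one_mul]
      congr 1
      refine Finset.sum_congr rfl fun k _ => ?_
      rw [Complex.real_smul]
      push_cast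
      ring
    · filter_upwards [self_mem_nhdsWithin] with t ht
      simp [abs_of_pos (show (0 : ℝ) < t from ht)]
  have hrtop : (fun t => h t - P t) =O[atTop] fun t => Real.exp (-(min a (1 / 2)) * t) := by
    have hmono : ∀ c : ℝ, min a (1 / 2) ≤ c →
        (fun t => Real.exp (-c * t)) =O[atTop] fun t => Real.exp (-(min a (1 / 2)) * t) := by
      intro c hc
      refine IsBigO.of_bound 1 ?_
      filter_upwards [eventually_ge_atTop 0] with t ht
      rw [one_mul, Real.norm_eq_abs, Real.norm_eq_abs, Real.abs_exp, Real.abs_exp, Real.exp_le_exp]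
      nlinarith
    refine (htop.trans (hmono a (min_le_left _ _))).sub (IsBigO.fun_sum fun k _ => ?_)
    exact ((isBigO_exp_neg_mul_pow k).const_mul_left _).trans (hmono _ (min_le_right _ _))
  have hrc : LocallyIntegrableOn (fun t => h t - P t) (Ioi 0) :=
    (hc.sub hPc.continuousOn).locallyIntegrableOn measurableSet_Ioi
  have hε : 0 < min a (1 / 2) := lt_min ha (by norm_num)
  -- The remainder is `O(t^n)` at `0`, so its Mellin transform is holomorphic for `-n < re s`; the
  -- quotients `Γ(s + k) / Γ(s)` are polynomials.
  refine ⟨fun s => (Complex.Gamma s)⁻¹ * mellin (fun t => h t - P t) s +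
    ∑ k ∈ Finset.range n, p.coeff k * (ascPochhammer ℂ k).eval s, fun s hs => ?_, fun s hs => ?_⟩
  · refine DifferentiableAt.differentiableWithinAt ?_
    refine (Complex.differentiable_one_div_Gamma s).mul
      (mellin_differentiableAt_of_isBigO_rpow_exp hε hrc hrtop hr0 hs) |>.add ?_
    refine DifferentiableAt.fun_sum fun k _ => ?_
    exact ((ascPochhammer ℂ k).differentiable s).const_mul _
  · have hG := Complex.Gamma_ne_zero_of_re_pos hs
    have hr : MellinConvergent (fun t => h t - P t) s :=
      mellinConvergent_of_isBigO_rpow_exp hε hrc hrtop hr0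
        (lt_of_le_of_lt (by simp) hs)
    have hPm : MellinConvergent P s ∧ mellin P s =
        ∑ k ∈ Finset.range n, p.coeff k * Complex.Gamma (s + k) := by
      have hk : ∀ k, HasMellin (fun t : ℝ => p.coeff k •
          (((Real.exp (-t) : ℝ) : ℂ) * (t : ℂ) ^ k)) s (p.coeff k • Complex.Gamma (s + k)) := by
        intro k
        have := hasMellin_exp_neg_mul_pow hs k
        rw [← this.2]
        exact hasMellin_const_smul this.1 _
      constructor
      · have := integrable_finsetSum (Finset.range n) (fun k _ => (hk k).1)
        refine this.congr (ae_of_all _ fun t => ?_)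
        simp only [hP, Finset.mul_sum, smul_eq_mul]
      · have := integral_finsetSum (Finset.range n) (fun k _ => (hk k).1)
        calc mellin P s = ∑ k ∈ Finset.range n, mellin (fun t : ℝ => p.coeff k •
              (((Real.exp (-t) : ℝ) : ℂ) * (t : ℂ) ^ k)) s := by
              unfold mellin
              rw [← this]
              simp only [hP, Finset.mul_sum, smul_eq_mul]
          _ = _ := Finset.sum_congr rfl fun k _ => by rw [(hk k).2, smul_eq_mul]
    have hsum := (hasMellin_add hr hPm.1).2
    simp only [sub_add_cancel] at hsum
    rw [hsum, hPm.2, mul_add, Finset.mul_sum]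
    refine congrArg _ (Finset.sum_congr rfl fun k _ => ?_)
    rw [Gamma_add_nat_eq_ascPochhammer_mul hs]
    field_simp

/-! ### Regularity and growth of the Barnes kernel -/

/-- The divided difference of `1 - e^(-ct)` at `0` is analytic with value `c ≠ 0` there, hence
invertible. -/
theorem exists_analyticAt_eq_mul_inv_one_sub_exp {c : ℝ} (hc : c ≠ 0) :
    ∃ u : ℝ → ℝ, AnalyticAt ℝ u 0 ∧
      ∀ t : ℝ, t ≠ 0 → t * (1 - Real.exp (-(c * t)))⁻¹ = u t := by
  have hf : AnalyticAt ℝ (fun t : ℝ => 1 - Real.exp (-(c * t))) 0 := by fun_prop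
  obtain ⟨p, hp⟩ := hf
  have hd : HasDerivAt (fun t : ℝ => 1 - Real.exp (-(c * t))) c 0 := by
    have h1 : HasDerivAt (fun t : ℝ => -(c * t)) (-(c * 1)) 0 := ((hasDerivAt_id 0).const_mul c).neg
    simpa using h1.exp.const_sub 1
  refine ⟨fun t => (dslope (fun t : ℝ => 1 - Real.exp (-(c * t))) 0 t)⁻¹,
    AnalyticAt.inv ⟨_, hp.has_fpower_series_dslope_fslope⟩ ?_, fun t ht => ?_⟩
  · rw [dslope_same, hd.deriv]
    exact hc
  · dsimp only
    rw [dslope_of_ne _ ht, slope_def_field]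
    simp [div_eq_mul_inv]

theorem barnesF_eq_prod {M : ℕ} (a : Fin M → ℝ) (t : ℝ) :
    barnesF a t = ∏ j, t * (1 - Real.exp (-(a j * t)))⁻¹ := by
  simp [barnesF, Finset.prod_mul_distrib]

theorem exists_analyticAt_eq_barnesF {M : ℕ} {a : Fin M → ℝ} (ha : ∀ i, 0 < a i) :
    ∃ u : ℝ → ℝ, AnalyticAt ℝ u 0 ∧ ∀ t : ℝ, t ≠ 0 → barnesF a t = u t := by
  choose u hu hut using fun j => exists_analyticAt_eq_mul_inv_one_sub_exp (ha j).ne'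
  refine ⟨fun t => ∏ j, u j t, Finset.analyticAt_fun_prod _ fun j _ => hu j, fun t ht => ?_⟩
  rw [barnesF_eq_prod]
  exact Finset.prod_congr rfl fun j _ => hut j t ht

theorem one_sub_exp_neg_pos {c t : ℝ} (hc : 0 < c) (ht : 0 < t) :
    0 < 1 - Real.exp (-(c * t)) := by
  rw [sub_pos, Real.exp_lt_one_iff]
  nlinarith [mul_pos hc ht]

theorem continuousOn_barnesF {M : ℕ} {a : Fin M → ℝ} (ha : ∀ i, 0 < a i) :
    ContinuousOn (barnesF a) (Ioi 0) := by
  unfold barnesF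
  refine (continuousOn_id.pow M).mul (continuousOn_finsetProd _ fun j _ => ?_)
  exact ContinuousOn.inv₀ (by fun_prop) fun t ht => (one_sub_exp_neg_pos (ha j) ht).ne'

theorem barnesF_isBigO_one {M : ℕ} {a : Fin M → ℝ} (ha : ∀ i, 0 < a i) :
    barnesF a =O[𝓝[>] 0] fun _ => (1 : ℝ) := by
  obtain ⟨u, hu, hut⟩ := exists_analyticAt_eq_barnesF ha
  refine ((hu.continuousAt.tendsto.isBigO_one ℝ).mono nhdsWithin_le_nhds).congr' ?_
    EventuallyEq.rfl
  filter_upwards [self_mem_nhdsWithin] with t ht using (hut t (ne_of_gt ht)).symm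

theorem barnesF_isBigO_pow {M : ℕ} {a : Fin M → ℝ} (ha : ∀ i, 0 < a i) :
    barnesF a =O[atTop] fun t => t ^ M := by
  have h : Tendsto (fun t : ℝ => ∏ j, (1 - Real.exp (-(a j * t)))⁻¹) atTop
      (𝓝 (∏ _j : Fin M, (1 - 0)⁻¹)) := by
    refine tendsto_finsetProd _ fun j _ => Tendsto.inv₀ (tendsto_const_nhds.sub ?_) (by norm_num)
    exact Real.tendsto_exp_neg_atTop_nhds_zero.comp (tendsto_id.const_mul_atTop (ha j))
  simpa only [barnesF, mul_one] using!
    (isBigO_refl (fun t : ℝ => t ^ M) atTop).mul (h.isBigO_one ℝ)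

theorem exp_mul_barnesF_isBigO {M : ℕ} {a : Fin M → ℝ} (ha : ∀ i, 0 < a i) {w : ℂ}
    (hw : 0 < w.re) :
    (fun t : ℝ => Complex.exp (-w * t) * (barnesF a t : ℂ)) =O[atTop]
      fun t => Real.exp (-(w.re / 2) * t) := by
  have h1 : (barnesF a) =O[atTop] fun t => Real.exp (w.re / 2 * t) :=
    (barnesF_isBigO_pow ha).trans (isLittleO_pow_exp_pos_mul_atTop M (half_pos hw)).isBigO
  have h2 := (isBigO_refl (fun t : ℝ => Real.exp (-w.re * t)) atTop).mul h1
  refine IsBigO.of_norm_left (h2.norm_left.congr' ?_ ?_)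
  · filter_upwards with t
    rw [norm_mul, norm_mul, Complex.norm_real, Complex.norm_exp, Real.norm_eq_abs, Real.abs_exp]
    simp
  · filter_upwards with t
    rw [← Real.exp_add]
    ring_nf

theorem exists_differentiable_eq_mellin_exp_mul_barnesF {M : ℕ} {a : Fin M → ℝ}
    (ha : ∀ i, 0 < a i) {w : ℂ} (hw : 0 < w.re) :
    ∃ φ : ℂ → ℂ, Differentiable ℂ φ ∧ ∀ s : ℂ, 0 < s.re → φ s = (Complex.Gamma s)⁻¹ *
      mellin (fun t : ℝ => Complex.exp (-w * t) * (barnesF a t : ℂ)) s := by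
  obtain ⟨u, hu, hut⟩ := exists_analyticAt_eq_barnesF ha
  refine exists_differentiable_eq_mellin_div_Gamma
    (H := fun t : ℝ => Complex.exp (-w * t) * (u t : ℂ)) ?_ ?_ ?_ (half_pos hw)
    (exp_mul_barnesF_isBigO ha hw)
  · have hof : AnalyticAt ℝ (fun t : ℝ => -w * (t : ℂ)) 0 :=
      analyticAt_const.mul (Complex.ofRealCLM.analyticAt _)
    refine AnalyticAt.mul ((analyticAt_cexp.restrictScalars (𝕜 := ℝ)).comp hof) ?_
    exact (Complex.ofRealCLM.analyticAt _).comp hu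
  · filter_upwards [self_mem_nhdsWithin] with t ht
    rw [hut t (ne_of_gt ht)]
  · refine ContinuousOn.mul (by fun_prop) ?_
    exact Complex.continuous_ofReal.comp_continuousOn (continuousOn_barnesF ha)

theorem mellinConvergent_exp_mul_barnesF {M : ℕ} {a : Fin M → ℝ} (ha : ∀ i, 0 < a i) {w : ℂ}
    (hw : 0 < w.re) {s : ℂ} (hs : 0 < s.re) :
    MellinConvergent (fun t : ℝ => Complex.exp (-w * t) * (barnesF a t : ℂ)) s := by
  refine mellinConvergent_of_isBigO_rpow_exp (b := 0) (half_pos hw) ?_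
    (exp_mul_barnesF_isBigO ha hw) ?_ hs
  · refine ContinuousOn.locallyIntegrableOn (ContinuousOn.mul (by fun_prop) ?_) measurableSet_Ioi
    exact Complex.continuous_ofReal.comp_continuousOn (continuousOn_barnesF ha)
  · have h1 : ContinuousAt (fun t : ℝ => Complex.exp (-w * t)) 0 := by fun_prop
    have h2 := ((h1.tendsto.isBigO_one ℝ).mono nhdsWithin_le_nhds).mul
      (Complex.isBigO_ofReal_left.2 (barnesF_isBigO_one ha))
    simpa using h2

/-! ### Continuation of the Barnes zeta function -/

theorem isConnected_compl_natCast_Icc (M : ℕ) :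
    IsOpen {s : ℂ | ∀ k : ℕ, 1 ≤ k → k ≤ M → s ≠ (k : ℂ)} ∧
      IsConnected {s : ℂ | ∀ k : ℕ, 1 ≤ k → k ≤ M → s ≠ (k : ℂ)} := by
  have e : {s : ℂ | ∀ k : ℕ, 1 ≤ k → k ≤ M → s ≠ (k : ℂ)} =
      ((fun k : ℕ => (k : ℂ)) '' (Icc 1 M))ᶜ := by
    ext s
    simp only [mem_ofPred_eq, mem_compl_iff, mem_image, mem_Icc, not_exists, not_and, and_imp]
    exact ⟨fun h k h1 h2 h3 => h k h1 h2 h3.symm, fun h k h1 h2 h3 => h k h1 h2 h3.symm⟩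
  have hfin : ((fun k : ℕ => (k : ℂ)) '' (Icc 1 M)).Finite := (finite_Icc 1 M).image _
  rw [e]
  exact ⟨hfin.isClosed.isOpen_compl,
    hfin.countable.isConnected_compl_of_one_lt_rank (by simp)⟩

theorem IsBarnesZetaContinuation.eqOn {M : ℕ} {a : Fin M → ℝ} {w : ℂ} {Z Z' : ℂ → ℂ}
    (hZ : IsBarnesZetaContinuation a w Z) (hZ' : IsBarnesZetaContinuation a w Z') :
    EqOn Z Z' {s : ℂ | ∀ k : ℕ, 1 ≤ k → k ≤ M → s ≠ (k : ℂ)} := by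
  obtain ⟨ho, hc⟩ := isConnected_compl_natCast_Icc M
  refine (hZ.1.analyticOnNhd ho).eqOn_of_preconnected_of_eventuallyEq (hZ'.1.analyticOnNhd ho)
    hc.isPreconnected (z₀ := ((M + 1 : ℕ) : ℂ)) ?_ ?_
  · intro k _ hk h
    have : M + 1 = k := by exact_mod_cast h
    omega
  · have : {s : ℂ | (M : ℝ) < s.re} ∈ 𝓝 (((M + 1 : ℕ) : ℂ)) :=
      (isOpen_lt continuous_const Complex.continuous_re).mem_nhds (by simp)
    filter_upwards [this] with s hs
    rw [hZ.2 s hs, hZ'.2 s hs]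

theorem ascPochhammer_eval_sub_ne_zero {M : ℕ} {s : ℂ}
    (hs : ∀ k : ℕ, 1 ≤ k → k ≤ M → s ≠ (k : ℂ)) : (ascPochhammer ℂ M).eval (s - M) ≠ 0 := by
  rw [Ne, ascPochhammer_eval_eq_zero_iff]
  rintro ⟨k, hk, h⟩
  refine hs (M - k) (by omega) (by omega) ?_
  rw [Nat.cast_sub hk.le, h]
  ring

theorem barnesZetaIntegral_eq {M : ℕ} (a : Fin M → ℝ) (w : ℂ) {s : ℂ} (hs : (M : ℝ) < s.re) :
    barnesZetaIntegral a w s = (Complex.Gamma (s - M))⁻¹ *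
      mellin (fun t : ℝ => Complex.exp (-w * t) * (barnesF a t : ℂ)) (s - M) /
        (ascPochhammer ℂ M).eval (s - M) := by
  have h := Gamma_add_nat_eq_ascPochhammer_mul (s := s - M) (by simpa using hs) M
  rw [sub_add_cancel] at h
  have hm : mellin (fun t : ℝ => Complex.exp (-w * (t : ℂ)) * ((barnesF a t / t ^ M : ℝ) : ℂ)) s =
      mellin (fun t : ℝ => Complex.exp (-w * t) * (barnesF a t : ℂ)) (s - M) := by
    rw [sub_eq_add_neg, ← mellin_cpow_smul]
    refine setIntegral_congr_fun measurableSet_Ioi fun t _ => ?_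
    simp only [Complex.cpow_neg, Complex.cpow_natCast, smul_eq_mul]
    push_cast
    ring
  rw [barnesZetaIntegral, hm, h, mul_inv]
  ring

/-- Exhibiting one continuation gives the `Classical.epsilon` in `barnesZeta` its meaning; the
identity theorem on the connected domain then identifies it with this formula. -/
theorem exists_differentiable_barnesZeta_eq {M : ℕ} {a : Fin M → ℝ} (ha : ∀ i, 0 < a i) {w : ℂ}
    (hw : 0 < w.re) :
    ∃ φ : ℂ → ℂ, Differentiable ℂ φ ∧
      (∀ s : ℂ, 0 < s.re → φ s = (Complex.Gamma s)⁻¹ *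
        mellin (fun t : ℝ => Complex.exp (-w * t) * (barnesF a t : ℂ)) s) ∧
      ∀ s : ℂ, (∀ k : ℕ, 1 ≤ k → k ≤ M → s ≠ (k : ℂ)) →
        barnesZeta a w s = φ (s - M) / (ascPochhammer ℂ M).eval (s - M) := by
  obtain ⟨φ, hφ, hφm⟩ := exists_differentiable_eq_mellin_exp_mul_barnesF ha hw
  have hZ : IsBarnesZetaContinuation a w
      fun s => φ (s - M) / (ascPochhammer ℂ M).eval (s - M) := by
    refine ⟨fun s hs => DifferentiableAt.differentiableWithinAt ?_, fun s hs => ?_⟩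
    · refine DifferentiableAt.fun_div ?_ ?_ (ascPochhammer_eval_sub_ne_zero hs)
      · exact hφ.differentiableAt.comp s (differentiableAt_id.sub_const _)
      · exact (ascPochhammer ℂ M).differentiableAt.comp s (differentiableAt_id.sub_const _)
    · dsimp only
      rw [barnesZetaIntegral_eq a w hs, hφm]
      simpa using hs
  exact ⟨φ, hφ, hφm, (Classical.epsilon_spec ⟨_, hZ⟩ :
    IsBarnesZetaContinuation a w (barnesZeta a w)).eqOn hZ⟩

/-! ### Integral representation of the alternating sum of log-gammas -/

theorem sum_neg_one_pow_mul_exp {N : ℕ} (x : Fin N → ℂ) :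
    ∑ K : Finset (Fin N), (-1) ^ K.card * Complex.exp (-∑ k ∈ K, x k) =
      ∏ k, (1 - Complex.exp (-x k)) := by
  simp_rw [sub_eq_add_neg]
  rw [Finset.prod_one_add, Finset.powerset_univ]
  refine Finset.sum_congr rfl fun K _ => ?_
  rw [← Finset.sum_neg_distrib, Complex.exp_sum, Finset.prod_neg]

/-- The function `e ^ (-b_0 t) ∏ k, (1 - e ^ (-b_k t)) ∏ j, (1 - e ^ (-a_j t))⁻¹`. -/
noncomputable def barnesWeight {M N : ℕ} (a : Fin M → ℝ) (b : Fin (N + 1) → ℝ) (t : ℝ) : ℝ :=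
  Real.exp (-(b 0 * t)) * (∏ k : Fin N, (1 - Real.exp (-(b k.succ * t)))) *
    ∏ j, (1 - Real.exp (-(a j * t)))⁻¹

/-- The integrand of the Mellin transform of `𝒮_N L_M`, multiplied by `t ^ M`. -/
noncomputable def barnesSIntegrand {M N : ℕ} (a : Fin M → ℝ) (b : Fin (N + 1) → ℝ) (q : ℂ)
    (t : ℝ) : ℂ :=
  (∏ k : Fin N, (1 - Complex.exp (-((b k.succ : ℂ) * t)))) *
    (Complex.exp (-(q + b 0) * t) * (barnesF a t : ℂ) -
      Complex.exp (-(b 0 : ℂ) * t) * (barnesF a t : ℂ))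

theorem barnesSIntegrand_eq {M N : ℕ} (a : Fin M → ℝ) (b : Fin (N + 1) → ℝ) (q : ℂ) (t : ℝ) :
    barnesSIntegrand a b q t =
      (t : ℂ) ^ M * ((Complex.exp (-q * t) - 1) * (barnesWeight a b t : ℂ)) := by
  have e : Complex.exp (-(q + b 0) * t) = Complex.exp (-q * t) * Complex.exp (-(b 0 : ℂ) * t) := by
    rw [← Complex.exp_add]
    ring_nf
  rw [barnesSIntegrand, barnesWeight, barnesF, e]
  push_cast
  rw [neg_mul (b 0 : ℂ)]
  ring

theorem barnesSIntegrand_isBigO_exp {M N : ℕ} {a : Fin M → ℝ} (ha : ∀ i, 0 < a i)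
    {b : Fin (N + 1) → ℝ} (hb : ∀ j, 0 < b j) {q : ℂ} (hq : -b 0 < q.re) :
    barnesSIntegrand a b q =O[atTop]
      fun t => Real.exp (-(min ((q.re + b 0) / 2) (b 0 / 2)) * t) := by
  have hmono : ∀ c : ℝ, min ((q.re + b 0) / 2) (b 0 / 2) ≤ c → (fun t => Real.exp (-c * t))
      =O[atTop] fun t => Real.exp (-(min ((q.re + b 0) / 2) (b 0 / 2)) * t) := by
    intro c hc
    refine IsBigO.of_bound 1 ?_
    filter_upwards [eventually_ge_atTop 0] with t ht
    rw [one_mul, Real.norm_eq_abs, Real.norm_eq_abs, Real.abs_exp, Real.abs_exp, Real.exp_le_exp]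
    nlinarith
  have h1 := exp_mul_barnesF_isBigO ha (w := q + b 0) (by
    simp only [Complex.add_re, Complex.ofReal_re]; linarith)
  have h2 := exp_mul_barnesF_isBigO ha (w := b 0) (by simpa using hb 0)
  simp only [Complex.add_re, Complex.ofReal_re] at h1 h2
  have h3 : (fun t : ℝ => ∏ k : Fin N, (1 - Complex.exp (-((b k.succ : ℂ) * t)))) =O[atTop]
      fun _ => (1 : ℝ) := by
    refine IsBigO.of_bound (∏ _k : Fin N, 2) ?_
    filter_upwards [eventually_ge_atTop 0] with t ht
    rw [norm_prod, norm_one, mul_one]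
    refine Finset.prod_le_prod (fun _ _ => norm_nonneg _) fun k _ => ?_
    refine (norm_sub_le _ _).trans ?_
    rw [norm_one, Complex.norm_exp]
    have : Real.exp (-((b k.succ : ℂ) * t)).re ≤ 1 := by
      rw [Real.exp_le_one_iff]
      have := mul_nonneg (hb k.succ).le ht
      simpa using this
    linarith
  simpa only [barnesSIntegrand, one_mul] using! h3.mul ((h1.trans (hmono _ (min_le_left _ _))).sub
    (h2.trans (hmono _ (min_le_right _ _))))

theorem one_sub_exp_isBigO (c : ℂ) :
    (fun t : ℝ => 1 - Complex.exp (-(c * t))) =O[𝓝[>] 0] fun t => t := by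
  have hd : HasDerivAt (fun t : ℂ => 1 - Complex.exp (-(c * t))) (-(Complex.exp (-(c * 0)) * -(c * 1)))
      ((0 : ℝ) : ℂ) := by
    rw [Complex.ofReal_zero]
    exact (((hasDerivAt_id (0 : ℂ)).const_mul c).neg.cexp).const_sub 1
  have := hd.comp_ofReal.isBigO_sub
  simpa using this.mono nhdsWithin_le_nhds

/-- Each of the `N` factors and the difference of exponentials is `O(t)`, while `f` is bounded. As
`M ≤ N`, the Mellin transform is holomorphic for `-(M + 1) < re s`, a neighbourhood of `-M`. -/
theorem barnesSIntegrand_isBigO_pow {M N : ℕ} (hMN : M ≤ N) {a : Fin M → ℝ} (ha : ∀ i, 0 < a i)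
    (b : Fin (N + 1) → ℝ) (q : ℂ) :
    barnesSIntegrand a b q =O[𝓝[>] 0] fun t => t ^ (-(-((M : ℝ) + 1))) := by
  have h1 : (fun t : ℝ => ∏ k : Fin N, (1 - Complex.exp (-((b k.succ : ℂ) * t)))) =O[𝓝[>] 0]
      fun t => ∏ _k : Fin N, t := IsBigO.finsetProd fun k _ => one_sub_exp_isBigO _
  have h2 : (fun t : ℝ => Complex.exp (-(q + b 0) * t) - Complex.exp (-(b 0 : ℂ) * t)) =O[𝓝[>] 0]
      fun t => t := by
    refine ((one_sub_exp_isBigO (b 0)).sub (one_sub_exp_isBigO (q + b 0))).congr_left fun t => ?_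
    rw [neg_mul, neg_mul]
    ring
  have h3 := h1.mul (h2.mul (Complex.isBigO_ofReal_left.2 (barnesF_isBigO_one ha)))
  have h4 : (fun t : ℝ => (∏ _k : Fin N, t) * (t * 1)) =O[𝓝[>] 0]
      fun t => t ^ (-(-((M : ℝ) + 1))) := by
    refine IsBigO.of_bound 1 ?_
    filter_upwards [Ioo_mem_nhdsGT (zero_lt_one (α := ℝ))] with t ht
    rw [neg_neg, Finset.prod_const, Finset.card_univ, Fintype.card_fin, mul_one, one_mul,
      ← pow_succ]
    have : t ^ ((M : ℝ) + 1) = t ^ (M + 1) := by exact_mod_cast Real.rpow_natCast t (M + 1)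
    rw [this, Real.norm_of_nonneg (by have := ht.1; positivity),
      Real.norm_of_nonneg (by have := ht.1; positivity)]
    exact pow_le_pow_of_le_one ht.1.le ht.2.le (by omega)
  refine (h3.trans h4).congr_left fun t => ?_
  rw [barnesSIntegrand, sub_mul]

theorem locallyIntegrableOn_barnesSIntegrand {M N : ℕ} {a : Fin M → ℝ} (ha : ∀ i, 0 < a i)
    (b : Fin (N + 1) → ℝ) (q : ℂ) : LocallyIntegrableOn (barnesSIntegrand a b q) (Ioi 0) := by
  have h := Complex.continuous_ofReal.comp_continuousOn (continuousOn_barnesF ha)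
  refine ContinuousOn.locallyIntegrableOn ?_ measurableSet_Ioi
  unfold barnesSIntegrand
  exact ContinuousOn.mul (by fun_prop)
    (((by fun_prop : ContinuousOn _ _).mul h).sub ((by fun_prop : ContinuousOn _ _).mul h))

theorem mellin_barnesSIntegrand {M N : ℕ} {a : Fin M → ℝ} (ha : ∀ i, 0 < a i)
    {b : Fin (N + 1) → ℝ} (hb : ∀ j, 0 < b j) {q : ℂ} (hq : -b 0 < q.re) {s : ℂ}
    (hs : 0 < s.re) :
    mellin (barnesSIntegrand a b q) s =
      ∑ K : Finset (Fin N), (-1) ^ K.card *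
        (mellin (fun t : ℝ => Complex.exp (-(q + (b 0 : ℂ) + ∑ k ∈ K, (b k.succ : ℂ)) * t) *
            (barnesF a t : ℂ)) s -
          mellin (fun t : ℝ => Complex.exp (-(0 + (b 0 : ℂ) + ∑ k ∈ K, (b k.succ : ℂ)) * t) *
            (barnesF a t : ℂ)) s) := by
  have hre : ∀ K : Finset (Fin N), 0 ≤ ∑ k ∈ K, b k.succ := fun K =>
    Finset.sum_nonneg fun k _ => (hb _).le
  have h1 : ∀ K : Finset (Fin N), 0 < (q + (b 0 : ℂ) + ∑ k ∈ K, (b k.succ : ℂ)).re := fun K => by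
    have := hre K
    simp only [Complex.add_re, Complex.ofReal_re, Complex.re_sum]
    linarith
  have h2 : ∀ K : Finset (Fin N), 0 < (0 + (b 0 : ℂ) + ∑ k ∈ K, (b k.succ : ℂ)).re := fun K => by
    have := hre K
    have := hb 0
    simp only [Complex.add_re, Complex.ofReal_re, Complex.re_sum, Complex.zero_re]
    linarith
  have h3 : ∀ K : Finset (Fin N), _ := fun K => hasMellin_sub
    (mellinConvergent_exp_mul_barnesF ha (h1 K) hs) (mellinConvergent_exp_mul_barnesF ha (h2 K) hs)
  have h4 : ∀ K : Finset (Fin N), _ := fun K => hasMellin_const_smul (h3 K).1 ((-1 : ℂ) ^ K.card)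
  have h5 := integral_finsetSum Finset.univ (fun K _ => (h4 K).1)
  calc mellin (barnesSIntegrand a b q) s = _ := ?_
    _ = _ := h5
    _ = _ := Finset.sum_congr rfl fun K _ => ?_
  · unfold mellin
    refine integral_congr_ae (ae_of_all _ fun t => ?_)
    simp only [barnesSIntegrand, smul_eq_mul]
    rw [← sum_neg_one_pow_mul_exp, ← Finset.mul_sum, Finset.sum_mul]
    congr 1
    refine Finset.sum_congr rfl fun K _ => ?_
    have e : ∀ z : ℂ, Complex.exp (-(z + ∑ k ∈ K, (b k.succ : ℂ)) * t) =
        Complex.exp (-∑ k ∈ K, (b k.succ : ℂ) * t) * Complex.exp (-z * t) := fun z => by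
      rw [← Complex.exp_add, ← Finset.sum_mul]
      ring_nf
    rw [e, e, zero_add]
    ring
  · exact ((h4 K).2.trans (by rw [(h3 K).2, smul_eq_mul]))

/-- No exception is needed at the poles, where `Complex.Gamma` takes the value `0` and its inverse
is `0`. This matters at `s - M` for `s` near `0`. -/
theorem inv_Gamma_eq_ascPochhammer_mul (k : ℕ) (s : ℂ) :
    (Complex.Gamma s)⁻¹ = (ascPochhammer ℂ k).eval s * (Complex.Gamma (s + k))⁻¹ := by
  induction k with
  | zero => simp
  | succ k ih =>
    rw [ih, Complex.one_div_Gamma_eq_self_mul_one_div_Gamma_add_one, ascPochhammer_succ_eval]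
    push_cast
    ring_nf

theorem hasDerivAt_inv_Gamma_zero :
    HasDerivAt (fun s : ℂ => (Complex.Gamma s)⁻¹) 1 0 := by
  have e : (fun s : ℂ => (Complex.Gamma s)⁻¹) = fun s => s * (Complex.Gamma (s + 1))⁻¹ :=
    funext Complex.one_div_Gamma_eq_self_mul_one_div_Gamma_add_one
  have hd : HasDerivAt (fun s : ℂ => (Complex.Gamma (s + 1))⁻¹)
      (deriv (fun s : ℂ => (Complex.Gamma (s + 1))⁻¹) 0) 0 :=
    (Complex.differentiable_one_div_Gamma.comp
      (differentiable_id.add_const (1 : ℂ))).differentiableAt.hasDerivAt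
  rw [e]
  simpa using! (hasDerivAt_id (0 : ℂ)).mul hd

/-- The integral representation of `𝒮_N L_M` up to an additive constant. -/
theorem barnesS_sub_barnesS {M N : ℕ} (hMN : M ≤ N) {a : Fin M → ℝ} (ha : ∀ i, 0 < a i)
    {b : Fin (N + 1) → ℝ} (hb : ∀ j, 0 < b j) {q : ℂ} (hq : -b 0 < q.re) :
    barnesS b (barnesLogGamma a) q - barnesS b (barnesLogGamma a) 0 =
      mellin (barnesSIntegrand a b q) (-M) := by
  have hre : ∀ K : Finset (Fin N), 0 ≤ ∑ k ∈ K, b k.succ := fun K =>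
    Finset.sum_nonneg fun k _ => (hb _).le
  have h1 : ∀ z : ℂ, -b 0 < z.re →
      ∀ K : Finset (Fin N), 0 < (z + (b 0 : ℂ) + ∑ k ∈ K, (b k.succ : ℂ)).re := fun z hz K => by
    have := hre K
    simp only [Complex.add_re, Complex.ofReal_re, Complex.re_sum]
    linarith
  have hq0 : -b 0 < (0 : ℂ).re := by simpa using hb 0
  choose φ hφd hφm hφZ using fun K => exists_differentiable_barnesZeta_eq ha (h1 q hq K)
  choose ψ hψd hψm hψZ using fun K => exists_differentiable_barnesZeta_eq ha (h1 0 hq0 K)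
  set D : ℂ → ℂ := fun s => ∑ K : Finset (Fin N), (-1) ^ K.card * (φ K s - ψ K s) with hD
  have hDd : Differentiable ℂ D := by
    refine Differentiable.fun_sum fun K _ => ?_
    exact ((hφd K).sub (hψd K)).const_mul _
  have hmd : ∀ s : ℂ, -((M : ℝ) + 1) < s.re →
      DifferentiableAt ℂ (mellin (barnesSIntegrand a b q)) s := fun s hs =>
    mellin_differentiableAt_of_isBigO_rpow_exp
      (lt_min (by linarith) (half_pos (hb 0))) (locallyIntegrableOn_barnesSIntegrand ha b q)
      (barnesSIntegrand_isBigO_exp ha hb hq) (barnesSIntegrand_isBigO_pow hMN ha b q) hs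
  -- Termwise the Mellin integrals make sense only for `0 < re s`; the cancellation in the sum lets
  -- the identity theorem carry the equality past `-M`.
  have hDeq : ∀ s : ℂ, -((M : ℝ) + 1) < s.re →
      D s = (Complex.Gamma s)⁻¹ * mellin (barnesSIntegrand a b q) s := by
    refine eqOn_halfPlane_of_eqOn (y := 0) hDd.differentiableOn
      (fun s hs => DifferentiableAt.differentiableWithinAt ?_) fun s hs => ?_
    · exact (Complex.differentiable_one_div_Gamma s).mul (hmd s hs)
    · rw [mellin_barnesSIntegrand ha hb hq hs, Finset.mul_sum]
      refine Finset.sum_congr rfl fun K _ => ?_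
      rw [hφm K s hs, hψm K s hs]
      ring
  obtain ⟨ho, _⟩ := isConnected_compl_natCast_Icc M
  have h0 : {s : ℂ | ∀ k : ℕ, 1 ≤ k → k ≤ M → s ≠ (k : ℂ)} ∈ 𝓝 (0 : ℂ) :=
    ho.mem_nhds fun k hk _ h => by
      have : 0 = k := by exact_mod_cast h
      omega
  have hdiff : ∀ w : ℂ, 0 < w.re → DifferentiableAt ℂ (barnesZeta a w) 0 := fun w hw => by
    obtain ⟨φ, hφ, -, hZ⟩ := exists_differentiable_barnesZeta_eq ha hw
    refine DifferentiableAt.congr_of_eventuallyEq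
      (f := fun s => φ (s - M) / (ascPochhammer ℂ M).eval (s - M)) ?_ (by
        filter_upwards [h0] with s hs using hZ s hs)
    refine DifferentiableAt.fun_div ?_ ?_ (ascPochhammer_eval_sub_ne_zero (mem_of_mem_nhds h0))
    · exact hφ.differentiableAt.comp 0 (differentiableAt_id.sub_const _)
    · exact (ascPochhammer ℂ M).differentiableAt.comp 0 (differentiableAt_id.sub_const _)
  have hsum : HasDerivAt (fun s => ∑ K : Finset (Fin N), (-1) ^ K.card *
      (barnesZeta a (q + (b 0 : ℂ) + ∑ k ∈ K, (b k.succ : ℂ)) s -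
        barnesZeta a (0 + (b 0 : ℂ) + ∑ k ∈ K, (b k.succ : ℂ)) s))
      (∑ K : Finset (Fin N), (-1) ^ K.card *
      (barnesLogGamma a (q + (b 0 : ℂ) + ∑ k ∈ K, (b k.succ : ℂ)) -
        barnesLogGamma a (0 + (b 0 : ℂ) + ∑ k ∈ K, (b k.succ : ℂ)))) 0 := by
    refine HasDerivAt.fun_sum fun K _ => HasDerivAt.const_mul _ ?_
    exact (hdiff _ (h1 q hq K)).hasDerivAt.sub (hdiff _ (h1 0 hq0 K)).hasDerivAt
  have hev : (fun s => ∑ K : Finset (Fin N), (-1) ^ K.card *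
      (barnesZeta a (q + (b 0 : ℂ) + ∑ k ∈ K, (b k.succ : ℂ)) s -
        barnesZeta a (0 + (b 0 : ℂ) + ∑ k ∈ K, (b k.succ : ℂ)) s)) =ᶠ[𝓝 0]
      fun s => (Complex.Gamma s)⁻¹ * mellin (barnesSIntegrand a b q) (s - M) := by
    have hre1 : {s : ℂ | -1 < s.re} ∈ 𝓝 (0 : ℂ) :=
      (isOpen_lt continuous_const Complex.continuous_re).mem_nhds (by simp)
    filter_upwards [h0, hre1] with s hs hs1
    have hne := ascPochhammer_eval_sub_ne_zero hs
    have hDs := hDeq (s - M) (by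
      have hs1 : -1 < s.re := hs1
      simp only [Complex.sub_re, Complex.natCast_re]
      linarith)
    -- The Pochhammer factor produced here cancels the denominator of the continued zeta function.
    rw [inv_Gamma_eq_ascPochhammer_mul M, sub_add_cancel] at hDs
    calc _ = D (s - M) / (ascPochhammer ℂ M).eval (s - M) := by
          rw [hD, Finset.sum_div]
          refine Finset.sum_congr rfl fun K _ => ?_
          rw [hφZ K s hs, hψZ K s hs]
          ring
      _ = _ := by
          rw [hDs]
          field_simp
  have hrhs : HasDerivAt (fun s => (Complex.Gamma s)⁻¹ * mellin (barnesSIntegrand a b q) (s - M))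
      (mellin (barnesSIntegrand a b q) (-M)) 0 := by
    have hm : HasDerivAt (fun s => mellin (barnesSIntegrand a b q) (s - M))
        (deriv (fun s => mellin (barnesSIntegrand a b q) (s - M)) 0) 0 := by
      exact (DifferentiableAt.comp (0 : ℂ) (g := mellin (barnesSIntegrand a b q))
        (f := fun s : ℂ => s - (M : ℂ)) (hmd _ (by simp)) (differentiableAt_id.sub_const _)).hasDerivAt
    -- Because `1/Γ` vanishes at `0`, the derivative of the Mellin factor drops out of the product
    -- rule.
    simpa using! hasDerivAt_inv_Gamma_zero.mul hm
  rw [hrhs.unique (hsum.congr_of_eventuallyEq hev.symm)]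
  simp only [barnesS, mul_sub, Finset.sum_sub_distrib]

theorem integrableOn_barnesWeight {M N : ℕ} (hMN : M ≤ N) {a : Fin M → ℝ} (ha : ∀ i, 0 < a i)
    {b : Fin (N + 1) → ℝ} (hb : ∀ j, 0 < b j) {q : ℂ} (hq : -b 0 < q.re) :
    IntegrableOn (fun t : ℝ => (Complex.exp (-q * t) - 1) * ((barnesWeight a b t / t : ℝ) : ℂ))
      (Ioi 0) ∧
    barnesS b (barnesLogGamma a) q - barnesS b (barnesLogGamma a) 0 =
      ∫ t in Ioi (0 : ℝ), (Complex.exp (-q * t) - 1) * ((barnesWeight a b t / t : ℝ) : ℂ) := by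
  have hconv : MellinConvergent (barnesSIntegrand a b q) (-M) :=
    mellinConvergent_of_isBigO_rpow_exp
      (lt_min (by linarith) (half_pos (hb 0))) (locallyIntegrableOn_barnesSIntegrand ha b q)
      (barnesSIntegrand_isBigO_exp ha hb hq) (barnesSIntegrand_isBigO_pow hMN ha b q) (by simp)
  have e : EqOn (fun t : ℝ => (t : ℂ) ^ (-(M : ℂ) - 1) • barnesSIntegrand a b q t)
      (fun t : ℝ => (Complex.exp (-q * t) - 1) * ((barnesWeight a b t / t : ℝ) : ℂ)) (Ioi 0) := by
    intro t ht
    have ht0 : (t : ℂ) ≠ 0 := by exact_mod_cast ne_of_gt ht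
    simp only [barnesSIntegrand_eq, smul_eq_mul]
    rw [Complex.cpow_sub _ _ ht0, Complex.cpow_neg, Complex.cpow_natCast, Complex.cpow_one]
    push_cast
    field_simp
  exact ⟨hconv.congr_fun e measurableSet_Ioi, (barnesS_sub_barnesS hMN ha hb hq).trans
    (setIntegral_congr_fun measurableSet_Ioi e)⟩

/-! ### Multiplicative infinitely divisible laws -/

theorem ofReal_prod_cpow {ι : Type*} (s : Finset ι) {x : ι → ℝ} (hx : ∀ i ∈ s, 0 ≤ x i) (q : ℂ) :
    ((∏ i ∈ s, x i : ℝ) : ℂ) ^ q = ∏ i ∈ s, (x i : ℂ) ^ q := by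
  classical
  induction s using Finset.induction_on with
  | empty => simp
  | insert i s hi ih =>
    rw [Finset.prod_insert hi, Finset.prod_insert hi, Complex.ofReal_mul,
      Complex.mul_cpow_ofReal_nonneg (hx i (Finset.mem_insert_self i s))
        (Finset.prod_nonneg fun j hj => hx j (Finset.mem_insert_of_mem hj)),
      ih fun j hj => hx j (Finset.mem_insert_of_mem hj)]

theorem measurable_ofReal_cpow_const (q : ℂ) : Measurable fun x : ℝ => (x : ℂ) ^ q :=
  Complex.measurable_ofReal.pow_const q

theorem prod_mem_Ioc {ι : Type*} (s : Finset ι) {x : ι → ℝ} (hx : ∀ i ∈ s, x i ∈ Ioc (0 : ℝ) 1) :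
    ∏ i ∈ s, x i ∈ Ioc (0 : ℝ) 1 :=
  ⟨Finset.prod_pos fun i hi => (hx i hi).1,
    Finset.prod_le_one (fun i hi => (hx i hi).1.le) fun i hi => (hx i hi).2⟩

/-- The multiplicative compound Poisson distribution with finite intensity measure on `(0, 1]`. -/
theorem exists_compoundPoisson (l : Measure ℝ) [IsFiniteMeasure l]
    (hl : ∀ᵐ x ∂l, x ∈ Ioc (0 : ℝ) 1) :
    ∃ μ : Measure ℝ, IsProbabilityMeasure μ ∧ (∀ᵐ x ∂μ, x ∈ Ioc (0 : ℝ) 1) ∧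
      ∀ q : ℂ, Integrable (fun x : ℝ => (x : ℂ) ^ q) l →
        Integrable (fun x : ℝ => (x : ℂ) ^ q) μ ∧
        ∫ x : ℝ, (x : ℂ) ^ q ∂μ = Complex.exp (∫ x : ℝ, ((x : ℂ) ^ q - 1) ∂l) := by
  set L : ℝ := l.real univ with hL
  set c : ℕ → ℝ := fun n => Real.exp (-L) / n.factorial with hc
  have hc0 : ∀ n, 0 ≤ c n := fun n => by positivity
  -- The `n`-fold multiplicative convolution of `l`, left unnormalised: its mass `L^n` is why `c n`
  -- carries no power of `L`.
  set ρ : ℕ → Measure ℝ := fun n =>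
    (Measure.pi fun _ : Fin n => l).map fun x => ∏ i, x i with hρ
  have hpm : ∀ n, Measurable fun x : Fin n → ℝ => ∏ i, x i := fun n => by fun_prop
  have hpi : ∀ n, ∀ᵐ x ∂(Measure.pi fun _ : Fin n => l), ∀ i, x i ∈ Ioc (0 : ℝ) 1 := fun n =>
    eventually_all.2 fun i => Measure.tendsto_eval_ae_ae.eventually hl
  have hρs : ∀ n, ∀ᵐ x ∂(ρ n), x ∈ Ioc (0 : ℝ) 1 := fun n => by
    refine (ae_map_iff (hpm n).aemeasurable measurableSet_Ioc).2 ?_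
    filter_upwards [hpi n] with x hx using prod_mem_Ioc _ fun i _ => hx i
  have hcongr : ∀ n, ∀ q : ℂ, (fun x : Fin n → ℝ => ((∏ i, x i : ℝ) : ℂ) ^ q)
      =ᵐ[Measure.pi fun _ : Fin n => l] fun x => ∏ i, (x i : ℂ) ^ q := fun n q => by
    filter_upwards [hpi n] with x hx using ofReal_prod_cpow _ (fun i _ => (hx i).1.le) q
  have hint : ∀ n, ∀ q : ℂ, Integrable (fun x : ℝ => (x : ℂ) ^ q) l →
      Integrable (fun x : ℝ => (x : ℂ) ^ q) (ρ n) := fun n q hq => by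
    rw [hρ, integrable_map_measure (measurable_ofReal_cpow_const q).aestronglyMeasurable
      (hpm n).aemeasurable]
    exact (Integrable.fintype_prod (fun _ => hq)).congr (hcongr n q).symm
  have hval : ∀ n, ∀ q : ℂ, ∫ x : ℝ, (x : ℂ) ^ q ∂(ρ n) = (∫ x : ℝ, (x : ℂ) ^ q ∂l) ^ n :=
    fun n q => by
      rw [hρ, integral_map (hpm n).aemeasurable
        (measurable_ofReal_cpow_const q).aestronglyMeasurable, integral_congr_ae (hcongr n q),
        integral_fintype_prod_eq_pow (fun x : ℝ => (x : ℂ) ^ q), Fintype.card_fin]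
  have hnorm : ∀ n, ∀ q : ℂ, ∫ x : ℝ, ‖(x : ℂ) ^ q‖ ∂(ρ n) = (∫ x : ℝ, ‖(x : ℂ) ^ q‖ ∂l) ^ n :=
    fun n q => by
      have h1 := integral_map (μ := Measure.pi fun _ : Fin n => l) (hpm n).aemeasurable
        (f := fun x : ℝ => ‖(x : ℂ) ^ q‖) (measurable_ofReal_cpow_const q).norm.aestronglyMeasurable
      have h2 : (fun x : Fin n → ℝ => ‖((∏ i, x i : ℝ) : ℂ) ^ q‖)
          =ᵐ[Measure.pi fun _ : Fin n => l] fun x => ∏ i, ‖(x i : ℂ) ^ q‖ := by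
        filter_upwards [hcongr n q] with x hx
        rw [hx, norm_prod]
      have h3 := integral_fintype_prod_eq_pow (ι := Fin n) (𝕜 := ℝ) (μ := l)
        (fun x : ℝ => ‖(x : ℂ) ^ q‖)
      rw [Fintype.card_fin] at h3
      exact h1.trans ((integral_congr_ae h2).trans h3)
  set μ : Measure ℝ := Measure.sum fun n => ENNReal.ofReal (c n) • ρ n with hμ
  have hμs : ∀ᵐ x ∂μ, x ∈ Ioc (0 : ℝ) 1 := by
    rw [hμ, Measure.ae_sum_iff]
    exact fun n => Measure.ae_smul_measure (hρs n) _
  have main : ∀ q : ℂ, Integrable (fun x : ℝ => (x : ℂ) ^ q) l →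
        Integrable (fun x : ℝ => (x : ℂ) ^ q) μ ∧
        ∫ x : ℝ, (x : ℂ) ^ q ∂μ = Complex.exp (∫ x : ℝ, ((x : ℂ) ^ q - 1) ∂l) := by
    intro q hq
    have hI : Integrable (fun x : ℝ => (x : ℂ) ^ q) μ := by
      refine integrable_sum_measure (fun n => (hint n q hq).smul_measure ENNReal.ofReal_ne_top) ?_
      simp only [integral_smul_measure, hnorm, ENNReal.toReal_ofReal (hc0 _), smul_eq_mul]
      refine ((Real.summable_pow_div_factorial (∫ x : ℝ, ‖(x : ℂ) ^ q‖ ∂l)).mul_left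
        (Real.exp (-L))).congr fun n => ?_
      simp only [hc]
      ring
    refine ⟨hI, ?_⟩
    have h1 := hasSum_integral_measure hI
    simp only [integral_smul_measure, hval, ENNReal.toReal_ofReal (hc0 _)] at h1
    have h2 := (NormedSpace.expSeries_div_hasSum_exp (∫ x : ℝ, (x : ℂ) ^ q ∂l)).mul_left
      (Complex.exp (-L))
    rw [← Complex.exp_eq_exp_ℂ] at h2
    have h3 : ∫ x : ℝ, ((x : ℂ) ^ q - 1) ∂l = -L + ∫ x : ℝ, (x : ℂ) ^ q ∂l := by
      rw [integral_sub hq (integrable_const _), integral_const, hL]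
      simp
      ring
    rw [h3, Complex.exp_add]
    refine h1.unique (h2.congr_fun fun n => ?_)
    simp only [hc, Complex.real_smul]
    push_cast
    ring
  refine ⟨μ, ?_, hμs, main⟩
  -- At `q = 0` the Mellin formula itself says that the total mass is `exp 0 = 1`.
  obtain ⟨h1, h2⟩ := main 0 (by simp)
  simp only [Complex.cpow_zero, sub_self, integral_zero, Complex.exp_zero] at h1 h2
  have : IsFiniteMeasure μ := by
    simpa [integrable_const_iff] using! h1
  rw [integral_const] at h2
  rw [isProbabilityMeasure_iff_real]
  simpa using h2

/-- The multiplicative infinitely divisible distribution with an s-finite intensity measure `l` on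
`(0, 1]` for which `x ^ q - 1` is integrable. -/
theorem exists_infinitelyDivisible (l : Measure ℝ) [SFinite l]
    (hl : ∀ᵐ x ∂l, x ∈ Ioc (0 : ℝ) 1) {c : ℝ} (hc : 0 < c)
    (hint : ∀ q : ℂ, -c < q.re → Integrable (fun x : ℝ => (x : ℂ) ^ q - 1) l) :
    ∃ μ : Measure ℝ, IsProbabilityMeasure μ ∧ (∀ᵐ x ∂μ, x ∈ Ioc (0 : ℝ) 1) ∧
      ∀ q : ℂ, -c < q.re →
        Integrable (fun x : ℝ => (x : ℂ) ^ q) μ ∧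
        ∫ x : ℝ, (x : ℂ) ^ q ∂μ = Complex.exp (∫ x : ℝ, ((x : ℂ) ^ q - 1) ∂l) := by
  have hle : ∀ n, sfiniteSeq l n ≤ l := fun n => by
    conv_rhs => rw [← sum_sfiniteSeq l]
    exact Measure.le_sum _ n
  choose ν hν hνs hνq using fun n => exists_compoundPoisson (sfiniteSeq l n)
    (Measure.absolutelyContinuous_of_le (hle n) hl)
  have hintn : ∀ n, ∀ q : ℂ, -c < q.re →
      Integrable (fun x : ℝ => (x : ℂ) ^ q) (sfiniteSeq l n) := fun n q hq => by
    have := ((hint q hq).mono_measure (hle n)).add (integrable_const (1 : ℂ))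
    refine this.congr (ae_of_all _ fun x => ?_)
    simp
  -- Independent factors, one for each finite piece of `l`; the partial products `Y n` are
  -- decreasing and so converge.
  set P : Measure (ℕ → ℝ) := Measure.infinitePi ν with hP
  have hPs : ∀ᵐ ω ∂P, ∀ i, ω i ∈ Ioc (0 : ℝ) 1 := by
    refine ae_all_iff.2 fun i => ?_
    exact (measurePreserving_eval_infinitePi ν i).quasiMeasurePreserving.ae (hνs i)
  set Y : ℕ → (ℕ → ℝ) → ℝ := fun n ω => ∏ i ∈ Finset.range n, ω i with hY
  have hYm : ∀ n, Measurable (Y n) := fun n => by fun_prop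
  have hYs : ∀ᵐ ω ∂P, ∀ n, Y n ω ∈ Ioc (0 : ℝ) 1 := by
    filter_upwards [hPs] with ω hω n using prod_mem_Ioc _ fun i _ => hω i
  have hYanti : ∀ᵐ ω ∂P, Antitone fun n => Y n ω := by
    filter_upwards [hPs, hYs] with ω hω hYω
    refine antitone_nat_of_succ_le fun n => ?_
    simp only [hY, Finset.prod_range_succ]
    exact mul_le_of_le_one_right (hYω n).1.le (hω n).2
  have hlim : ∀ᵐ ω ∂P, ∃ y : ℝ, Tendsto (fun n => Y n ω) atTop (𝓝 y) := by
    filter_upwards [hYs, hYanti] with ω hω ha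
    exact ⟨_, tendsto_atTop_ciInf ha ⟨0, by rintro _ ⟨n, rfl⟩; exact (hω n).1.le⟩⟩
  obtain ⟨X, hXm, hX⟩ := measurable_limit_of_tendsto_metrizable_ae
    (fun n => (hYm n).aemeasurable) hlim
  have hYq : ∀ q : ℂ, -c < q.re → ∀ n, Integrable (fun ω => (Y n ω : ℂ) ^ q) P ∧
      ∫ ω, (Y n ω : ℂ) ^ q ∂P =
        Complex.exp (∑ i ∈ Finset.range n, ∫ x : ℝ, ((x : ℂ) ^ q - 1) ∂(sfiniteSeq l i)) := by
    intro q hq n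
    set I := Finset.range n
    have hmp : MeasurePreserving I.restrict P (Measure.pi fun i : I => ν i) :=
      ⟨by fun_prop, Measure.infinitePi_map_restrict ν⟩
    have hG : Integrable (fun x : I → ℝ => ∏ i, (x i : ℂ) ^ q) (Measure.pi fun i : I => ν i) :=
      Integrable.fintype_prod_dep (f := fun _ (x : ℝ) => (x : ℂ) ^ q)
        fun i : I => (hνq i q (hintn i q hq)).1
    have hcongr : (fun ω => (Y n ω : ℂ) ^ q) =ᵐ[P]
        fun ω => ∏ i, ((I.restrict ω i : ℝ) : ℂ) ^ q := by
      filter_upwards [hPs] with ω hω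
      simp only [hY]
      rw [ofReal_prod_cpow _ (fun i _ => (hω i).1.le), ← Finset.prod_coe_sort]
      rfl
    refine ⟨(hmp.integrable_comp_of_integrable hG).congr hcongr.symm, ?_⟩
    rw [integral_congr_ae hcongr, Complex.exp_sum, ← Finset.prod_coe_sort]
    have h1 := integral_map (μ := P) hmp.measurable.aemeasurable
      (f := fun x : I → ℝ => ∏ i, (x i : ℂ) ^ q) (by rw [hmp.map_eq]; exact hG.1)
    rw [← h1, hmp.map_eq, integral_fintype_prod_eq_prod (fun (_ : I) (x : ℝ) => (x : ℂ) ^ q)]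
    exact Finset.prod_congr rfl fun i _ => (hνq i q (hintn i q hq)).2
  have hYlim : ∀ q : ℂ, -c < q.re → Tendsto (fun n => ∫ ω, (Y n ω : ℂ) ^ q ∂P) atTop
      (𝓝 (Complex.exp (∫ x : ℝ, ((x : ℂ) ^ q - 1) ∂l))) := by
    intro q hq
    have h1 : HasSum (fun i => ∫ x : ℝ, ((x : ℂ) ^ q - 1) ∂(sfiniteSeq l i))
        (∫ x : ℝ, ((x : ℂ) ^ q - 1) ∂l) := by
      have := hasSum_integral_measure (μ := sfiniteSeq l) (f := fun x : ℝ => (x : ℂ) ^ q - 1)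
        (by rw [sum_sfiniteSeq]; exact hint q hq)
      rwa [sum_sfiniteSeq] at this
    simp only [(hYq q hq _).2]
    exact (Complex.continuous_exp.tendsto _).comp h1.tendsto_sum_nat
  -- Fatou's lemma, in `ENNReal` so that `0 ^ r = ⊤` for `r < 0`: finiteness for one negative
  -- exponent excludes `X = 0`.
  have hXfin : ∀ r : ℝ, -c < r → ∫⁻ ω, ENNReal.ofReal (X ω) ^ r ∂P < ⊤ := by
    intro r hr
    have hr' : -c < (r : ℂ).re := by simpa using hr
    have h1 : ∀ n, ∫⁻ ω, ENNReal.ofReal (Y n ω) ^ r ∂P =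
        ENNReal.ofReal ‖∫ ω, (Y n ω : ℂ) ^ (r : ℂ) ∂P‖ := by
      intro n
      have hcast : (fun ω => (Y n ω : ℂ) ^ (r : ℂ)) =ᵐ[P] fun ω => ((Y n ω ^ r : ℝ) : ℂ) := by
        filter_upwards [hYs] with ω hω using (Complex.ofReal_cpow (hω n).1.le r).symm
      have hnn : 0 ≤ᵐ[P] fun ω => Y n ω ^ r := by
        filter_upwards [hYs] with ω hω using Real.rpow_nonneg (hω n).1.le r
      have hi : Integrable (fun ω => Y n ω ^ r) P := by
        have := ((hYq r hr' n).1.congr hcast).re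
        simpa using! this
      rw [integral_congr_ae hcast, integral_complex_ofReal, Complex.norm_real, Real.norm_of_nonneg
        (integral_nonneg_of_ae hnn), ofReal_integral_eq_lintegral_ofReal hi hnn]
      refine lintegral_congr_ae ?_
      filter_upwards [hYs] with ω hω using ENNReal.ofReal_rpow_of_pos (hω n).1
    have h2 : Tendsto (fun n => ∫⁻ ω, ENNReal.ofReal (Y n ω) ^ r ∂P) atTop
        (𝓝 (ENNReal.ofReal ‖Complex.exp (∫ x : ℝ, ((x : ℂ) ^ (r : ℂ) - 1) ∂l)‖)) := by
      simp only [h1]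
      exact ENNReal.tendsto_ofReal (hYlim r hr').norm
    calc ∫⁻ ω, ENNReal.ofReal (X ω) ^ r ∂P
        = ∫⁻ ω, liminf (fun n => ENNReal.ofReal (Y n ω) ^ r) atTop ∂P := by
          refine lintegral_congr_ae ?_
          filter_upwards [hX] with ω hω
          refine (Tendsto.liminf_eq ?_).symm
          exact (ENNReal.continuous_rpow_const.tendsto _).comp (ENNReal.tendsto_ofReal hω)
      _ ≤ liminf (fun n => ∫⁻ ω, ENNReal.ofReal (Y n ω) ^ r ∂P) atTop :=
          lintegral_liminf_le fun n => (hYm n).ennreal_ofReal.pow_const r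
      _ < ⊤ := by
          rw [h2.liminf_eq]
          exact ENNReal.ofReal_lt_top
  have hXs : ∀ᵐ ω ∂P, X ω ∈ Ioc (0 : ℝ) 1 := by
    have hr : -(c / 2) < 0 := by linarith
    filter_upwards [hX, hYs, ae_lt_top (hXm.ennreal_ofReal.pow_const _)
      (hXfin (-(c / 2)) (by linarith)).ne] with ω h1 h2 h3
    refine ⟨?_, le_of_tendsto' h1 fun n => (h2 n).2⟩
    by_contra h
    rw [ENNReal.ofReal_of_nonpos (not_lt.1 h), ENNReal.zero_rpow_of_neg hr] at h3
    exact lt_irrefl _ h3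
  have hXint : ∀ r : ℝ, -c < r → Integrable (fun ω => X ω ^ r) P := by
    intro r hr
    refine ⟨(hXm.pow_const r).aestronglyMeasurable, ?_⟩
    rw [hasFiniteIntegral_iff_ofReal]
    · refine lt_of_eq_of_lt (lintegral_congr_ae ?_) (hXfin r hr)
      filter_upwards [hXs] with ω hω using (ENNReal.ofReal_rpow_of_pos hω.1).symm
    · filter_upwards [hXs] with ω hω using Real.rpow_nonneg hω.1.le r
  refine ⟨P.map X, Measure.isProbabilityMeasure_map hXm.aemeasurable,
    (ae_map_iff hXm.aemeasurable measurableSet_Ioc).2 hXs, fun q hq => ?_⟩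
  rw [integrable_map_measure (measurable_ofReal_cpow_const q).aestronglyMeasurable
    hXm.aemeasurable, integral_map hXm.aemeasurable
    (measurable_ofReal_cpow_const q).aestronglyMeasurable]
  refine ⟨(hXint q.re hq).mono' ((measurable_ofReal_cpow_const q).comp
    hXm).aestronglyMeasurable ?_, ?_⟩
  · filter_upwards [hXs] with ω hω
      using (Complex.norm_cpow_eq_rpow_re_of_pos hω.1 q).le
  -- Since `X ≤ Y n ≤ 1`, the norm of `(Y n) ^ q` is at most `X ^ min (re q) 0`, which is
  -- integrable.
  · refine tendsto_nhds_unique (tendsto_integral_of_dominated_convergence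
      (fun ω => X ω ^ (min q.re 0)) (fun n => (hYq q hq n).1.1)
      (hXint _ (lt_min hq (by linarith))) (fun n => ?_) ?_) (hYlim q hq)
    · filter_upwards [hXs, hX, hYs, hYanti] with ω h1 h2 h3 h4
      rw [Complex.norm_cpow_eq_rpow_re_of_pos (h3 n).1]
      refine (Real.rpow_le_rpow_of_exponent_ge (h3 n).1 (h3 n).2 (min_le_left _ 0)).trans ?_
      exact Real.rpow_le_rpow_of_nonpos h1.1 (h4.le_of_tendsto h2 n) (min_le_right _ _)
    · filter_upwards [hXs, hX] with ω h1 h2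
      exact (Complex.continuousAt_ofReal_cpow_const _ _ (Or.inr h1.1.ne')).tendsto.comp h2

/-! ### Existence and uniqueness of the Barnes beta law -/

/-- On the imaginary axis the Mellin transform is the characteristic function of `log x`, and `exp`
recovers the measure from its image under `log`. -/
theorem eq_of_forall_integral_cpow_eq {μ ν : Measure ℝ} [IsFiniteMeasure μ] [IsFiniteMeasure ν]
    (hμ : ∀ᵐ x ∂μ, 0 < x) (hν : ∀ᵐ x ∂ν, 0 < x)
    (h : ∀ t : ℝ, ∫ x : ℝ, (x : ℂ) ^ (t * Complex.I) ∂μ =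
      ∫ x : ℝ, (x : ℂ) ^ (t * Complex.I) ∂ν) : μ = ν := by
  have hmap : ∀ ρ : Measure ℝ, (∀ᵐ x ∂ρ, 0 < x) → (ρ.map Real.log).map Real.exp = ρ := by
    intro ρ hρ
    rw [Measure.map_map Real.measurable_exp Real.measurable_log]
    conv_rhs => rw [← Measure.map_id (μ := ρ)]
    refine Measure.map_congr ?_
    filter_upwards [hρ] with x hx using Real.exp_log hx
  have hchar : ∀ ρ : Measure ℝ, (∀ᵐ x ∂ρ, 0 < x) → ∀ t : ℝ,
      charFun (ρ.map Real.log) t = ∫ x : ℝ, (x : ℂ) ^ (t * Complex.I) ∂ρ := by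
    intro ρ hρ t
    rw [charFun_apply_real, integral_map Real.measurable_log.aemeasurable (by fun_prop)]
    refine integral_congr_ae ?_
    filter_upwards [hρ] with x hx
    rw [Complex.cpow_def_of_ne_zero (by exact_mod_cast hx.ne'), Complex.ofReal_log hx.le]
    ring_nf
  have : μ.map Real.log = ν.map Real.log := by
    refine Measure.ext_of_charFun (funext fun t => ?_)
    rw [hchar μ hμ, hchar ν hν, h]
  rw [← hmap μ hμ, ← hmap ν hν, this]

theorem barnesWeight_div_nonneg {M N : ℕ} {a : Fin M → ℝ} (ha : ∀ i, 0 < a i)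
    {b : Fin (N + 1) → ℝ} (hb : ∀ j, 0 < b j) {t : ℝ} (ht : 0 < t) :
    0 ≤ barnesWeight a b t / t := by
  refine div_nonneg (mul_nonneg (mul_nonneg (Real.exp_pos _).le ?_) ?_) ht.le
  · exact Finset.prod_nonneg fun k _ => (one_sub_exp_neg_pos (hb k.succ) ht).le
  · exact Finset.prod_nonneg fun j _ => (inv_pos.2 (one_sub_exp_neg_pos (ha j) ht)).le

theorem measurable_barnesWeight_div {M N : ℕ} (a : Fin M → ℝ) (b : Fin (N + 1) → ℝ) :
    Measurable fun t => barnesWeight a b t / t := by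
  unfold barnesWeight
  fun_prop

theorem exists_isBarnesBetaLaw {M N : ℕ} (hMN : M ≤ N) {a : Fin M → ℝ} (ha : ∀ i, 0 < a i)
    {b : Fin (N + 1) → ℝ} (hb : ∀ j, 0 < b j) : ∃ μ, IsBarnesBetaLaw a b μ := by
  have hm := (measurable_barnesWeight_div a b).ennreal_ofReal
  have hexp : Measurable fun t : ℝ => Real.exp (-t) := by fun_prop
  -- The Lévy measure `W(t) dt/t` of `-log β`; its image under `e^(-t)` is the intensity on `(0,
  -- 1]`.
  set v : Measure ℝ := (volume.restrict (Ioi 0)).withDensity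
    fun t => ENNReal.ofReal (barnesWeight a b t / t) with hv
  have hvpos : ∀ᵐ t ∂v, t ∈ Ioi (0 : ℝ) :=
    (withDensity_absolutelyContinuous _ _).ae_le (ae_restrict_mem measurableSet_Ioi)
  have hcpow : ∀ (q : ℂ) (t : ℝ), ((Real.exp (-t) : ℝ) : ℂ) ^ q = Complex.exp (-q * t) := by
    intro q t
    rw [Complex.cpow_def_of_ne_zero (by exact_mod_cast (Real.exp_pos _).ne'),
      ← Complex.ofReal_log (Real.exp_pos _).le, Real.log_exp]
    push_cast
    ring_nf
  have hsm : ∀ q : ℂ, AEStronglyMeasurable (fun x : ℝ => (x : ℂ) ^ q - 1)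
      (v.map fun t => Real.exp (-t)) := fun q =>
    ((measurable_ofReal_cpow_const q).sub_const 1).aestronglyMeasurable
  have hdens : ∀ q : ℂ, (fun t : ℝ => (Complex.exp (-q * t) - 1) * ((barnesWeight a b t / t : ℝ) : ℂ))
      =ᵐ[volume.restrict (Ioi 0)] fun t => (ENNReal.ofReal (barnesWeight a b t / t)).toReal •
        (Complex.exp (-q * t) - 1) := fun q => by
    filter_upwards [ae_restrict_mem measurableSet_Ioi] with t ht
    rw [ENNReal.toReal_ofReal (barnesWeight_div_nonneg ha hb ht), Complex.real_smul, mul_comm]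
  obtain ⟨μ, hμ, hμs, hμq⟩ := exists_infinitelyDivisible (v.map fun t => Real.exp (-t)) (by
      refine (ae_map_iff hexp.aemeasurable measurableSet_Ioc).2 ?_
      filter_upwards [hvpos] with t ht
      exact ⟨Real.exp_pos _, Real.exp_le_one_iff.2 (neg_nonpos.2 (le_of_lt ht))⟩) (hb 0) (by
      intro q hq
      rw [integrable_map_measure (hsm q) hexp.aemeasurable]
      simp only [Function.comp_def, hcpow]
      rw [hv, integrable_withDensity_iff_integrable_smul' hm (ae_of_all _ fun _ =>
        ENNReal.ofReal_lt_top)]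
      exact (integrableOn_barnesWeight hMN ha hb hq).1.congr (hdens q))
  refine ⟨μ, hμ, hμs, fun q hq => (hμq q hq).1, fun q hq => ?_⟩
  rw [(hμq q hq).2, barnesEta, (integrableOn_barnesWeight hMN ha hb hq).2,
    integral_map hexp.aemeasurable (hsm q), integral_congr_ae (hdens q)]
  simp only [hcpow]
  rw [hv, integral_withDensity_eq_integral_toReal_smul hm (ae_of_all _ fun _ =>
        ENNReal.ofReal_lt_top)]

theorem IsBarnesBetaLaw.unique {M N : ℕ} {a : Fin M → ℝ} {b : Fin (N + 1) → ℝ} (hb : 0 < b 0)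
    {μ ν : Measure ℝ} (hμ : IsBarnesBetaLaw a b μ) (hν : IsBarnesBetaLaw a b ν) : μ = ν := by
  have := hμ.isProbabilityMeasure
  have := hν.isProbabilityMeasure
  have hpos : ∀ ρ : Measure ℝ, ρ (Ioc (0 : ℝ) 1)ᶜ = 0 → ∀ᵐ x ∂ρ, 0 < x := fun ρ hρ => by
    have : ∀ᵐ x ∂ρ, x ∈ Ioc (0 : ℝ) 1 := hρ
    exact this.mono fun x hx => hx.1
  refine eq_of_forall_integral_cpow_eq (hpos μ hμ.support) (hpos ν hν.support) fun t => ?_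
  have ht : -b 0 < (t * Complex.I).re := by simpa using hb
  rw [hμ.mellin_eq _ ht, hν.mellin_eq _ ht]

/-! ### Scaling -/

theorem barnesWeight_const_mul {M N : ℕ} (a : Fin M → ℝ) (b : Fin (N + 1) → ℝ) (κ t : ℝ) :
    barnesWeight (fun i => κ * a i) (fun j => κ * b j) t = barnesWeight a b (κ * t) := by
  simp only [barnesWeight, mul_assoc, mul_left_comm κ]

/-- Substituting `t ↦ κt` in the integral representation: `κq · t = q · κt`, and `dt/t` does not
change. -/
theorem barnesEta_const_mul {M N : ℕ} (hMN : M ≤ N) {a : Fin M → ℝ} (ha : ∀ i, 0 < a i)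
    {b : Fin (N + 1) → ℝ} (hb : ∀ j, 0 < b j) {κ : ℝ} (hκ : 0 < κ) {q : ℂ} (hq : -b 0 < q.re) :
    barnesEta (fun i => κ * a i) (fun j => κ * b j) (κ * q) = barnesEta a b q := by
  have hq' : -(κ * b 0) < ((κ : ℂ) * q).re := by
    rw [Complex.re_ofReal_mul]
    nlinarith
  rw [barnesEta, barnesEta, (integrableOn_barnesWeight hMN (fun i => mul_pos hκ (ha i))
    (fun j => mul_pos hκ (hb j)) hq').2, (integrableOn_barnesWeight hMN ha hb hq).2]
  congr 1
  have h := integral_comp_mul_left_Ioi (fun t : ℝ => (Complex.exp (-q * t) - 1) *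
    ((barnesWeight a b t / t : ℝ) : ℂ)) 0 hκ
  rw [mul_zero, eq_inv_smul_iff₀ hκ.ne'] at h
  rw [← h, ← integral_smul]
  refine setIntegral_congr_fun measurableSet_Ioi fun t ht => ?_
  have hκ' : (κ : ℂ) ≠ 0 := by exact_mod_cast hκ.ne'
  have ht' : (t : ℂ) ≠ 0 := by exact_mod_cast ne_of_gt ht
  simp only [barnesWeight_const_mul, Complex.real_smul]
  push_cast
  rw [show -((κ : ℂ) * q) * t = -q * (κ * t) by ring]
  field_simp

/-- For positive `x`, `(x ^ κ) ^ q = x ^ (κq)`, so the moment of order `q` of the image is `η` for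
`(κa, κb)` at `κq`. The condition `-b_0 < re q` becomes exactly `-κb_0 < re (κq)`. -/
theorem IsBarnesBetaLaw.map_rpow {M N : ℕ} (hMN : M ≤ N) {a : Fin M → ℝ} (ha : ∀ i, 0 < a i)
    {b : Fin (N + 1) → ℝ} (hb : ∀ j, 0 < b j) {κ : ℝ} (hκ : 0 < κ) {ν : Measure ℝ}
    (hν : IsBarnesBetaLaw (fun i => κ * a i) (fun j => κ * b j) ν) :
    IsBarnesBetaLaw a b (ν.map fun x => x ^ κ) := by
  have := hν.isProbabilityMeasure
  have hm : Measurable fun x : ℝ => x ^ κ := by fun_prop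
  have hs : ∀ᵐ x ∂ν, x ∈ Ioc (0 : ℝ) 1 := hν.support
  have hcongr : ∀ q : ℂ, (fun x : ℝ => (x : ℂ) ^ (κ * q)) =ᵐ[ν]
      fun x => ((x ^ κ : ℝ) : ℂ) ^ q := fun q => by
    filter_upwards [hs] with x hx
    rw [Complex.cpow_mul_ofReal_nonneg hx.1.le]
  have hq' : ∀ q : ℂ, -b 0 < q.re → -(κ * b 0) < ((κ : ℂ) * q).re := fun q hq => by
    rw [Complex.re_ofReal_mul]
    nlinarith
  refine ⟨Measure.isProbabilityMeasure_map hm.aemeasurable, ?_, fun q hq => ?_, fun q hq => ?_⟩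
  · refine (ae_map_iff hm.aemeasurable measurableSet_Ioc).2 ?_
    filter_upwards [hs] with x hx
    exact ⟨Real.rpow_pos_of_pos hx.1 κ, Real.rpow_le_one hx.1.le hx.2 hκ.le⟩
  · rw [integrable_map_measure (measurable_ofReal_cpow_const q).aestronglyMeasurable
      hm.aemeasurable]
    exact (hν.integrable _ (hq' q hq)).congr (hcongr q)
  · rw [integral_map hm.aemeasurable (measurable_ofReal_cpow_const q).aestronglyMeasurable,
      ← integral_congr_ae (hcongr q), hν.mellin_eq _ (hq' q hq),
      barnesEta_const_mul hMN ha hb hκ hq]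

theorem mainTheorem8 (M N : ℕ) (hMN : M ≤ N)
    (a : Fin M → ℝ) (ha : ∀ i, 0 < a i) (b : Fin (N + 1) → ℝ) (hb : ∀ j, 0 < b j)
    (κ : ℝ) (hκ : 0 < κ) :
    (∃! μ : Measure ℝ, IsBarnesBetaLaw a b μ) ∧
    (∃! ν : Measure ℝ, IsBarnesBetaLaw (fun i => κ * a i) (fun j => κ * b j) ν) ∧
    Measure.map (fun x : ℝ => x ^ κ) (barnesBeta (fun i => κ * a i) (fun j => κ * b j)) =
      barnesBeta a b := by
  have hκa : ∀ i, 0 < κ * a i := fun i => mul_pos hκ (ha i)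
  have hκb : ∀ j, 0 < κ * b j := fun j => mul_pos hκ (hb j)
  obtain ⟨μ, hμ⟩ := exists_isBarnesBetaLaw hMN ha hb
  obtain ⟨ν, hν⟩ := exists_isBarnesBetaLaw hMN hκa hκb
  refine ⟨⟨μ, hμ, fun _ h => h.unique (hb 0) hμ⟩, ⟨ν, hν, fun _ h => h.unique (hκb 0) hν⟩, ?_⟩
  have h1 : IsBarnesBetaLaw a b (barnesBeta a b) := Classical.epsilon_spec ⟨μ, hμ⟩
  have h2 : IsBarnesBetaLaw (fun i => κ * a i) (fun j => κ * b j)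
      (barnesBeta (fun i => κ * a i) (fun j => κ * b j)) := Classical.epsilon_spec ⟨ν, hν⟩
  exact (h2.map_rpow hMN ha hb hκ).unique (hb 0) h1
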